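/- For a permutation $\pi=\pi_1\pi_2\ldots\pi_n$ of $\{1,\ldots,n\}$ in one-line notation, let the pinnacle set be $\operatorname{Pin}\pi=\{\pi_i \mid 1<i<n,\ \pi_{i-1}<\pi_i>\pi_{i+1}\}$, and for a finite set $S$ of positive integers let $p_S(n)$ be the number of permutations $\pi$ of $\{1,\ldots,n\}$ with $\operatorname{Pin}\pi=S$. Let $n\ge 1$. Then: (1) $p_\emptyset(n)=2^{n-1}$. (2) If $S=\{l\}$ with $3\le l\le n$, then $p_S(n)=2^{n-2}(2^{l-2}-1)$. (3) If $S=\{l,m\}$ with $l\ge 3$, $m\ge 5$ and $l<m\le n$, then $$p_S(n)=2^{n+m-l-5}(3^{l-1}-2^l+1)-2^{n-3}(2^{l-2}-1).$$ -/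

import Mathlib

namespace PinnacleSets

/-- The pinnacle set of a permutation `π = π₁ π₂ … πₙ` of `{1, …, n}` in one-line notation: the set
of all values `πᵢ` with `πᵢ₋₁ < πᵢ > πᵢ₊₁`, where both neighbours have to exist.
A permutation of `{1, …, n}` is given as a permutation of `Fin n = {0, …, n - 1}`; the positions
and the values are shifted by one, so that the value at position `i` is `π i + 1`. -/
def pinnacleSet {n : ℕ} (π : Equiv.Perm (Fin n)) : Finset ℕ :=
  (Finset.univ.filter fun i : Fin n =>
      ∃ a b : Fin n, (a : ℕ) + 1 = (i : ℕ) ∧ (b : ℕ) = (i : ℕ) + 1 ∧ π a < π i ∧ π b < π i).image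
    fun i => (π i : ℕ) + 1

/-- `p_S(n)`, the number of permutations of `{1, …, n}` whose pinnacle set is `S`. -/
def pinnacleCount (S : Finset ℕ) (n : ℕ) : ℕ :=
  (Finset.univ.filter fun π : Equiv.Perm (Fin n) => pinnacleSet π = S).card

end PinnacleSets

namespace PinnacleSets

open Finset

/-! Build permutations of `{1, …, n + 1}` by inserting `n + 1` into one of the `n + 1` gaps of a
permutation of `{1, …, n}`. At either end nothing changes. In an interior gap `n + 1` becomes a
pinnacle and destroys the peak touching that gap, if any. Peaks are never adjacent, so each touches
two interior gaps of its own. Hence `p_S(n+1) = 2 p_S(n)` if `n + 1 ∉ S`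
(`pinnacleCount_succ_of_notMem`), and otherwise, with `S = T ∪ {n+1}`, `p_S(n+1) = (n - 1 - 2|T|)
p_T(n) + 2 ∑ p_{T ∪ {x}}(n)` over `x ∉ T` (`pinnacleCount_insert_succ`). Induction on `n` gives the
closed forms, using geometric sums. -/

/-! ### Words and their peaks -/

/-- The one-line notation of `π` with values in `{1, …, n}`, indexed from `0`, extended by `0`. -/
def word {n : ℕ} (π : Equiv.Perm (Fin n)) (i : ℕ) : ℕ :=
  if h : i < n then (π ⟨i, h⟩ : ℕ) + 1 else 0

/-- The positions of the interior local maxima of the word `f 0, …, f (n - 1)`. -/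
def peaks (n : ℕ) (f : ℕ → ℕ) : Finset ℕ :=
  (range n).filter fun i => 1 ≤ i ∧ i + 1 < n ∧ f (i - 1) < f i ∧ f (i + 1) < f i

/-- Insert the value `c` at position `p` of the word `f`. -/
def insertAt (f : ℕ → ℕ) (p c j : ℕ) : ℕ :=
  if j < p then f j else if j = p then c else f (j - 1)

theorem mem_peaks {n : ℕ} {f : ℕ → ℕ} {i : ℕ} :
    i ∈ peaks n f ↔ 1 ≤ i ∧ i + 1 < n ∧ f (i - 1) < f i ∧ f (i + 1) < f i := by
  simp only [peaks, mem_filter, mem_range]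
  exact ⟨fun h => h.2, fun h => ⟨by omega, h⟩⟩

theorem word_of_lt {n : ℕ} (π : Equiv.Perm (Fin n)) {i : ℕ} (h : i < n) :
    word π i = (π ⟨i, h⟩ : ℕ) + 1 := by
  simp [word, h]

theorem word_le {n : ℕ} (π : Equiv.Perm (Fin n)) (i : ℕ) : word π i ≤ n := by
  unfold word
  split_ifs with h
  · exact (π ⟨i, h⟩).isLt
  · exact Nat.zero_le _

theorem word_injOn {n : ℕ} (π : Equiv.Perm (Fin n)) : Set.InjOn (word π) {i | i < n} := by
  intro i hi j hj h
  rw [word_of_lt π hi, word_of_lt π hj] at h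
  have := π.injective (Fin.ext (Nat.succ_injective h))
  exact congrArg Fin.val this

theorem word_injOn_peaks {n : ℕ} (π : Equiv.Perm (Fin n)) :
    Set.InjOn (word π) (peaks n (word π)) :=
  (word_injOn π).mono fun i hi => by
    have := mem_peaks.1 (mem_coe.1 hi)
    simp only [Set.mem_ofPred_eq]
    omega

theorem pinnacleSet_eq_image {n : ℕ} (π : Equiv.Perm (Fin n)) :
    pinnacleSet π = (peaks n (word π)).image (word π) := by
  ext v
  simp only [pinnacleSet, mem_image, mem_filter, mem_univ, true_and, mem_peaks]
  constructor
  · rintro ⟨i, ⟨a, b, ha, hb, h1, h2⟩, rfl⟩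
    refine ⟨i, ⟨by omega, by omega, ?_, ?_⟩, word_of_lt π i.isLt⟩
    · have : (i : ℕ) - 1 = a := by omega
      rw [this, word_of_lt π a.isLt, word_of_lt π i.isLt]
      exact Nat.succ_lt_succ h1
    · rw [← hb, word_of_lt π b.isLt, word_of_lt π i.isLt]
      exact Nat.succ_lt_succ h2
  · rintro ⟨i, ⟨h0, h1, h2, h3⟩, rfl⟩
    have hi : i < n := by omega
    have hi' : i - 1 < n := by omega
    rw [word_of_lt π hi, word_of_lt π hi'] at h2
    rw [word_of_lt π hi, word_of_lt π h1] at h3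
    refine ⟨⟨i, hi⟩, ⟨⟨i - 1, hi'⟩, ⟨i + 1, h1⟩, by simp; omega, rfl, ?_, ?_⟩,
      (word_of_lt π hi).symm⟩
    · exact Nat.lt_of_succ_lt_succ h2
    · exact Nat.lt_of_succ_lt_succ h3

/-! ### Inserting a dominating value into a word -/

theorem insertAt_lt {f : ℕ → ℕ} {p c j : ℕ} (h : j < p) : insertAt f p c j = f j := by
  simp [insertAt, h]

theorem insertAt_self {f : ℕ → ℕ} {p c : ℕ} : insertAt f p c p = c := by
  simp [insertAt]

theorem insertAt_succ {f : ℕ → ℕ} {p c j : ℕ} (h : p ≤ j) : insertAt f p c (j + 1) = f j := by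
  have h1 : ¬ j + 1 < p := by omega
  have h2 : j + 1 ≠ p := by omega
  simp [insertAt, h1, h2]

theorem mem_peaks_insertAt_lt {n p c j : ℕ} {f : ℕ → ℕ} (hf : ∀ i, f i < c) (hp : p ≤ n)
    (hj : j < p) : j ∈ peaks (n + 1) (insertAt f p c) ↔ j ∈ peaks n f ∧ j + 1 ≠ p := by
  rw [mem_peaks, mem_peaks, insertAt_lt hj, insertAt_lt (show j - 1 < p by omega)]
  rcases Nat.lt_or_ge (j + 1) p with h | h
  · rw [insertAt_lt h]
    constructor
    · rintro ⟨h1, h2, h3, h4⟩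
      exact ⟨⟨h1, by omega, h3, h4⟩, by omega⟩
    · rintro ⟨⟨h1, h2, h3, h4⟩, -⟩
      exact ⟨h1, by omega, h3, h4⟩
  · have h' : j + 1 = p := by omega
    rw [h', insertAt_self]
    have := hf j
    constructor
    · rintro ⟨-, -, -, h4⟩
      omega
    · rintro ⟨-, h⟩
      exact absurd rfl h

theorem self_mem_peaks_insertAt {n p c : ℕ} {f : ℕ → ℕ} (hf : ∀ i, f i < c) :
    p ∈ peaks (n + 1) (insertAt f p c) ↔ 0 < p ∧ p < n := by
  rw [mem_peaks, insertAt_self, insertAt_succ le_rfl]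
  constructor
  · rintro ⟨h1, h2, -, -⟩
    omega
  · rintro ⟨h1, h2⟩
    rw [insertAt_lt (show p - 1 < p by omega)]
    exact ⟨h1, by omega, hf _, hf _⟩

theorem succ_mem_peaks_insertAt {n p c j : ℕ} {f : ℕ → ℕ} (hf : ∀ i, f i < c)
    (hj : p ≤ j) : j + 1 ∈ peaks (n + 1) (insertAt f p c) ↔ j ∈ peaks n f ∧ j ≠ p := by
  rw [mem_peaks, mem_peaks, insertAt_succ hj, insertAt_succ (show p ≤ j + 1 by omega),
    Nat.add_sub_cancel]
  rcases Nat.eq_or_lt_of_le hj with rfl | h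
  · rw [insertAt_self]
    have := hf p
    constructor
    · rintro ⟨-, -, h3, -⟩
      omega
    · rintro ⟨-, h⟩
      exact absurd rfl h
  · obtain ⟨k, rfl⟩ : ∃ k, j = k + 1 := ⟨j - 1, by omega⟩
    rw [insertAt_succ (show p ≤ k by omega), Nat.add_sub_cancel]
    constructor
    · rintro ⟨h1, h2, h3, h4⟩
      exact ⟨⟨by omega, by omega, h3, h4⟩, by omega⟩
    · rintro ⟨⟨h1, h2, h3, h4⟩, -⟩
      exact ⟨by omega, by omega, h3, h4⟩

/-- Since `c` dominates, only the old peaks next to gap `p`, at positions `p` and `p - 1`, are lost.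
-/
theorem image_peaks_insertAt {n p c : ℕ} {f : ℕ → ℕ} (hf : ∀ i, f i < c) (hp : p ≤ n) :
    (peaks (n + 1) (insertAt f p c)).image (insertAt f p c) =
      (if 0 < p ∧ p < n then {c} else ∅) ∪
        ((peaks n f).filter fun i => i ≠ p ∧ i + 1 ≠ p).image f := by
  ext v
  simp only [mem_union, mem_image, mem_filter]
  constructor
  · rintro ⟨j, hj, rfl⟩
    rcases lt_trichotomy j p with h | rfl | h
    · rw [mem_peaks_insertAt_lt hf hp h] at hj
      exact Or.inr ⟨j, ⟨hj.1, by omega, hj.2⟩, (insertAt_lt h).symm⟩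
    · rw [self_mem_peaks_insertAt hf] at hj
      left
      simp [hj, insertAt_self]
    · obtain ⟨k, rfl⟩ : ∃ k, j = k + 1 := ⟨j - 1, by omega⟩
      have hk : p ≤ k := by omega
      rw [succ_mem_peaks_insertAt hf hk] at hj
      exact Or.inr ⟨k, ⟨hj.1, hj.2, by omega⟩, (insertAt_succ hk).symm⟩
  · rintro (h | ⟨i, ⟨hi, h1, h2⟩, rfl⟩)
    · split_ifs at h with h'
      · rw [mem_singleton] at h
        subst h
        exact ⟨p, (self_mem_peaks_insertAt hf).2 h', insertAt_self⟩
      · simp at h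
    · rcases Nat.lt_or_ge i p with h | h
      · exact ⟨i, (mem_peaks_insertAt_lt hf hp h).2 ⟨hi, h2⟩, insertAt_lt h⟩
      · exact ⟨i + 1, (succ_mem_peaks_insertAt hf h).2 ⟨hi, h1⟩, insertAt_succ h⟩

/-! ### Inserting the maximum into a permutation -/

/-- Insert the largest value at position `p` of a permutation. -/
def insertMax {n : ℕ} (p : Fin (n + 1)) (σ : Equiv.Perm (Fin n)) : Equiv.Perm (Fin (n + 1)) :=
  (finSuccEquiv' p).trans ((Equiv.optionCongr σ).trans (finSuccEquiv' (Fin.last n)).symm)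

theorem insertMax_self {n : ℕ} (p : Fin (n + 1)) (σ : Equiv.Perm (Fin n)) :
    insertMax p σ p = Fin.last n := by
  simp [insertMax]

theorem insertMax_succAbove {n : ℕ} (p : Fin (n + 1)) (σ : Equiv.Perm (Fin n)) (i : Fin n) :
    insertMax p σ (p.succAbove i) = (σ i).castSucc := by
  simp [insertMax]

theorem insertMax_injective (n : ℕ) : Function.Injective
    fun x : Fin (n + 1) × Equiv.Perm (Fin n) => insertMax x.1 x.2 := by
  rintro ⟨p, σ⟩ ⟨q, τ⟩ h
  simp only at h
  have hpq : p = q := by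
    apply (insertMax q τ).injective
    rw [insertMax_self, ← h, insertMax_self]
  subst hpq
  congr 1
  ext i
  have := congrArg (fun π : Equiv.Perm (Fin (n + 1)) => π (p.succAbove i)) h
  simp only [insertMax_succAbove] at this
  exact congrArg Fin.val (Fin.castSucc_injective _ this)

theorem insertMax_bijective (n : ℕ) : Function.Bijective
    fun x : Fin (n + 1) × Equiv.Perm (Fin n) => insertMax x.1 x.2 := by
  rw [Fintype.bijective_iff_injective_and_card]
  refine ⟨insertMax_injective n, ?_⟩
  simp [Fintype.card_perm, Nat.factorial_succ]

theorem word_insertMax {n : ℕ} (p : Fin (n + 1)) (σ : Equiv.Perm (Fin n)) :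
    word (insertMax p σ) = insertAt (word σ) p (n + 1) := by
  funext j
  rcases Nat.lt_or_ge j (n + 1) with hj | hj
  · rw [word_of_lt _ hj]
    rcases Fin.eq_self_or_eq_succAbove p ⟨j, hj⟩ with h | ⟨i, h⟩
    · have : j = p := congrArg Fin.val h
      rw [h, insertMax_self, this, insertAt_self, Fin.val_last]
    · rw [h, insertMax_succAbove]
      have hv : j = (p.succAbove i : ℕ) := congrArg Fin.val h
      rw [hv, Fin.val_castSucc]
      rcases Nat.lt_or_ge (i : ℕ) p with h' | h'
      · rw [Fin.succAbove_of_castSucc_lt p i h', Fin.val_castSucc, insertAt_lt h',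
          word_of_lt σ i.isLt]
      · rw [Fin.succAbove_of_le_castSucc p i h', Fin.val_succ, insertAt_succ h',
          word_of_lt σ i.isLt]
  · obtain ⟨k, rfl⟩ : ∃ k, j = k + 1 := ⟨j - 1, by omega⟩
    rw [insertAt_succ (by omega)]
    simp only [word]
    rw [dif_neg (by omega), dif_neg (by omega)]

theorem pinnacleSet_insertMax {n : ℕ} (p : Fin (n + 1)) (σ : Equiv.Perm (Fin n)) :
    pinnacleSet (insertMax p σ) = (if 0 < (p : ℕ) ∧ (p : ℕ) < n then {n + 1} else ∅) ∪
      ((peaks n (word σ)).filter fun i => i ≠ (p : ℕ) ∧ i + 1 ≠ (p : ℕ)).image (word σ) := by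
  rw [pinnacleSet_eq_image, word_insertMax,
    image_peaks_insertAt (fun i => Nat.lt_succ_of_le (word_le σ i)) (by omega)]

theorem pinnacleSet_insertMax_of_end {n : ℕ} (p : Fin (n + 1)) (σ : Equiv.Perm (Fin n))
    (hp : ¬ (0 < (p : ℕ) ∧ (p : ℕ) < n)) : pinnacleSet (insertMax p σ) = pinnacleSet σ := by
  rw [pinnacleSet_insertMax, if_neg hp, empty_union, pinnacleSet_eq_image σ]
  congr 1
  apply filter_true_of_mem
  intro i hi
  have := mem_peaks.1 hi
  omega

theorem bounds_of_mem_pinnacleSet {n : ℕ} {σ : Equiv.Perm (Fin n)} {x : ℕ}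
    (hx : x ∈ pinnacleSet σ) : 0 < x ∧ x ≤ n := by
  simp only [pinnacleSet, mem_image] at hx
  obtain ⟨i, -, rfl⟩ := hx
  omega

/-! ### Recurrences for the counts -/

theorem pinnacleCount_eq_sum (S : Finset ℕ) (n : ℕ) :
    pinnacleCount S n = ∑ σ : Equiv.Perm (Fin n), if pinnacleSet σ = S then 1 else 0 := by
  rw [pinnacleCount, card_filter]

theorem pinnacleCount_succ_eq_sum (S : Finset ℕ) (n : ℕ) :
    pinnacleCount S (n + 1) = ∑ σ : Equiv.Perm (Fin n), ∑ p : Fin (n + 1),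
      if pinnacleSet (insertMax p σ) = S then 1 else 0 := by
  rw [pinnacleCount_eq_sum, ← (insertMax_bijective n).sum_comp, Fintype.sum_prod_type, sum_comm]

theorem pinnacleCount_succ_of_notMem {S : Finset ℕ} {n : ℕ} (hn : 1 ≤ n) (hS : n + 1 ∉ S) :
    pinnacleCount S (n + 1) = 2 * pinnacleCount S n := by
  rw [pinnacleCount_succ_eq_sum, pinnacleCount_eq_sum, mul_sum]
  refine sum_congr rfl fun σ _ => ?_
  obtain ⟨k, rfl⟩ : ∃ k, n = k + 1 := ⟨n - 1, by omega⟩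
  -- The first and last gaps, distinct as `n ≥ 1`, are split off; every interior gap would create
  -- the pinnacle `n + 1`.
  rw [Fin.sum_univ_succ, Fin.sum_univ_castSucc, sum_eq_zero,
    pinnacleSet_insertMax_of_end _ _ (by simp), pinnacleSet_insertMax_of_end _ _ (by simp)]
  · ring
  · intro q _
    rw [if_neg]
    intro h
    apply hS
    rw [← h, pinnacleSet_insertMax, if_pos (by simp)]
    simp

/-- Peak `i` touches gaps `i` and `i + 1`; these pairs are disjoint, leaving `n - 1 - 2 * card` gaps
of value `a`. The additive form avoids truncated subtraction. -/
theorem sum_peak_adjacent {n : ℕ} {f : ℕ → ℕ} (F G : ℕ → ℕ) (a : ℕ)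
    (hF : ∀ p, 0 < p → p < n → p ∉ peaks n f → p - 1 ∉ peaks n f → F p = a)
    (hG : ∀ i ∈ peaks n f, F i = G i ∧ F (i + 1) = G i) :
    ∑ p ∈ Ioo 0 n, F p + 2 * (peaks n f).card * a =
      (n - 1) * a + 2 * ∑ i ∈ peaks n f, G i := by
  set K := peaks n f with hK
  set L := K.map (addRightEmbedding 1) with hL
  have hdisj : Disjoint K L := by
    rw [disjoint_left]
    intro i hi hi'
    rw [hL, mem_map] at hi'
    obtain ⟨j, hj, rfl⟩ := hi'
    have h1 := mem_peaks.1 hi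
    have h2 := mem_peaks.1 hj
    simp only [addRightEmbedding_apply, Nat.add_sub_cancel] at h1
    omega
  have hsub : K ∪ L ⊆ Ioo 0 n := by
    intro i hi
    rw [mem_union] at hi
    rw [mem_Ioo]
    rcases hi with hi | hi
    · have := mem_peaks.1 hi
      omega
    · rw [hL, mem_map] at hi
      obtain ⟨j, hj, rfl⟩ := hi
      have := mem_peaks.1 hj
      simp only [addRightEmbedding_apply]
      omega
  have hrest : ∑ p ∈ Ioo 0 n \ (K ∪ L), F p = (Ioo 0 n \ (K ∪ L)).card * a := by
    rw [← smul_eq_mul, ← sum_const]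
    refine sum_congr rfl fun p hp => ?_
    rw [mem_sdiff, mem_Ioo, mem_union, not_or] at hp
    refine hF p hp.1.1 hp.1.2 hp.2.1 fun h => hp.2.2 ?_
    rw [hL, mem_map]
    exact ⟨p - 1, h, by simp only [addRightEmbedding_apply]; omega⟩
  have hcard : (Ioo 0 n \ (K ∪ L)).card + 2 * K.card = n - 1 := by
    have h := card_sdiff_add_card_eq_card hsub
    have hLcard : L.card = K.card := card_map _
    rw [card_union_of_disjoint hdisj, hLcard, Nat.card_Ioo] at h
    omega
  rw [← sum_sdiff hsub, sum_union hdisj, hrest, hL, sum_map, ← hcard,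
    sum_congr rfl fun i hi => (hG i hi).1]
  simp only [addRightEmbedding_apply]
  rw [sum_congr rfl fun i hi => (hG i hi).2]
  ring

theorem pinnacleSet_insertMax_eq_insert_iff {n : ℕ} {p : Fin (n + 1)} {σ : Equiv.Perm (Fin n)}
    {S : Finset ℕ} (hS : n + 1 ∉ S) (hp : 0 < (p : ℕ) ∧ (p : ℕ) < n) :
    pinnacleSet (insertMax p σ) = insert (n + 1) S ↔
      ((peaks n (word σ)).filter fun i => i ≠ (p : ℕ) ∧ i + 1 ≠ (p : ℕ)).image (word σ) = S := by
  rw [pinnacleSet_insertMax, if_pos hp, ← insert_eq]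
  have h : n + 1 ∉
      ((peaks n (word σ)).filter fun i => i ≠ (p : ℕ) ∧ i + 1 ≠ (p : ℕ)).image (word σ) := by
    intro h
    obtain ⟨i, -, hi⟩ := mem_image.1 h
    have := word_le σ i
    omega
  constructor
  · intro h'
    rw [← erase_insert h, h', erase_insert hS]
  · rintro rfl
    rfl

theorem image_filter_ne {n : ℕ} (σ : Equiv.Perm (Fin n)) {i : ℕ}
    (hi : i ∈ peaks n (word σ)) (P : ℕ → Prop) [DecidablePred P]
    (hP : ∀ j ∈ peaks n (word σ), P j ↔ j ≠ i) :
    ((peaks n (word σ)).filter P).image (word σ) = (pinnacleSet σ).erase (word σ i) := by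
  rw [filter_congr hP, pinnacleSet_eq_image]
  ext v
  simp only [mem_image, mem_filter, mem_erase]
  constructor
  · rintro ⟨j, ⟨hj, hji⟩, rfl⟩
    exact ⟨fun h => hji (word_injOn_peaks σ hj hi h), j, hj, rfl⟩
  · rintro ⟨hv, j, hj, rfl⟩
    exact ⟨j, ⟨hj, fun h => hv (h ▸ rfl)⟩, rfl⟩

/-- Either the gap touches no peak and `σ` already has pinnacle set `S`, or it removes one pinnacle
`x` of `σ`, in two ways. -/
theorem sum_insertMax_eq_insert {n : ℕ} {S : Finset ℕ} (hS : n + 1 ∉ S)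
    (σ : Equiv.Perm (Fin n)) :
    (∑ p : Fin (n + 1), if pinnacleSet (insertMax p σ) = insert (n + 1) S then 1 else 0) +
        2 * S.card * (if pinnacleSet σ = S then 1 else 0) =
      (n - 1) * (if pinnacleSet σ = S then 1 else 0) +
        2 * ∑ x ∈ range (n + 1) \ S, if pinnacleSet σ = insert x S then 1 else 0 := by
  set F : ℕ → ℕ := fun p =>
    if ((peaks n (word σ)).filter fun i => i ≠ p ∧ i + 1 ≠ p).image (word σ) = S then 1 else 0
    with hFdef
  set G : ℕ → ℕ := fun i => if (pinnacleSet σ).erase (word σ i) = S then 1 else 0 with hGdef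
  have hsum : (∑ p : Fin (n + 1),
      if pinnacleSet (insertMax p σ) = insert (n + 1) S then 1 else 0) = ∑ p ∈ Ioo 0 n, F p := by
    have h1 : ∀ p : Fin (n + 1),
        (if pinnacleSet (insertMax p σ) = insert (n + 1) S then 1 else 0) =
          if 0 < (p : ℕ) ∧ (p : ℕ) < n then F p else 0 := by
      intro p
      by_cases hp : 0 < (p : ℕ) ∧ (p : ℕ) < n
      · rw [if_pos hp]
        simp only [hFdef, pinnacleSet_insertMax_eq_insert_iff hS hp]
      · rw [if_neg hp, pinnacleSet_insertMax_of_end p σ hp, if_neg]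
        intro h
        have := bounds_of_mem_pinnacleSet (h ▸ mem_insert_self (n + 1) S)
        omega
    rw [sum_congr rfl fun p _ => h1 p,
      Fin.sum_univ_eq_sum_range (fun p => if 0 < p ∧ p < n then F p else 0), ← sum_filter]
    refine sum_congr ?_ fun _ _ => rfl
    ext p
    simp only [mem_filter, mem_range, mem_Ioo]
    omega
  have hmain := sum_peak_adjacent (n := n) (f := word σ) F G
    (if pinnacleSet σ = S then 1 else 0) ?_ ?_
  · have hcard : (peaks n (word σ)).card * (if pinnacleSet σ = S then 1 else 0) =
        S.card * (if pinnacleSet σ = S then 1 else 0) := by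
      split_ifs with h
      · rw [← h, pinnacleSet_eq_image, card_image_of_injOn (word_injOn_peaks σ)]
      · rfl
    have hG : ∑ i ∈ peaks n (word σ), G i =
        ∑ x ∈ range (n + 1) \ S, if pinnacleSet σ = insert x S then 1 else 0 := by
      have h1 : ∑ i ∈ peaks n (word σ), G i =
          ∑ x ∈ pinnacleSet σ, if (pinnacleSet σ).erase x = S then 1 else 0 := by
        conv_rhs => rw [pinnacleSet_eq_image σ, sum_image (word_injOn_peaks σ)]
        rw [← pinnacleSet_eq_image σ]
      rw [h1, ← card_filter, ← card_filter]
      congr 1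
      ext x
      simp only [mem_filter, mem_sdiff, mem_range]
      constructor
      · rintro ⟨hx, rfl⟩
        have := bounds_of_mem_pinnacleSet hx
        exact ⟨⟨by omega, by simp⟩, (insert_erase hx).symm⟩
      · rintro ⟨⟨-, hx⟩, h⟩
        rw [h]
        exact ⟨mem_insert_self _ _, erase_insert hx⟩
    rw [hsum, ← hG, mul_assoc, ← hcard, ← mul_assoc]
    exact hmain
  · intro p _ _ h1 h2
    simp only [hFdef]
    rw [pinnacleSet_eq_image, filter_true_of_mem]
    intro i hi
    refine ⟨fun h => h1 (h ▸ hi), fun h => h2 ?_⟩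
    rwa [← h, Nat.add_sub_cancel]
  · intro i hi
    have hi' := mem_peaks.1 hi
    simp only [hFdef, hGdef]
    rw [image_filter_ne σ hi, image_filter_ne σ hi]
    · exact ⟨rfl, rfl⟩
    · intro j hj
      have hj' := mem_peaks.1 hj
      refine ⟨fun h => by omega, fun h => ⟨?_, by omega⟩⟩
      rintro rfl
      rw [Nat.add_sub_cancel] at hj'
      omega
    · intro j hj
      have hj' := mem_peaks.1 hj
      refine ⟨fun h => h.1, fun h => ⟨h, ?_⟩⟩
      rintro rfl
      rw [Nat.add_sub_cancel] at hi'
      omega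

theorem pinnacleCount_insert_succ {n : ℕ} (hn : 1 ≤ n) {S : Finset ℕ} (hS : n + 1 ∉ S) :
    (pinnacleCount (insert (n + 1) S) (n + 1) : ℚ) =
      (n - 1 - 2 * S.card) * pinnacleCount S n +
        2 * ∑ x ∈ range (n + 1) \ S, (pinnacleCount (insert x S) n : ℚ) := by
  have h : pinnacleCount (insert (n + 1) S) (n + 1) + 2 * S.card * pinnacleCount S n =
      (n - 1) * pinnacleCount S n +
        2 * ∑ x ∈ range (n + 1) \ S, pinnacleCount (insert x S) n := by
    simp only [pinnacleCount_succ_eq_sum, pinnacleCount_eq_sum]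
    rw [sum_comm (s := range (n + 1) \ S)]
    simp only [mul_sum (s := (univ : Finset (Equiv.Perm (Fin n)))), ← sum_add_distrib]
    exact sum_congr rfl fun σ _ => sum_insertMax_eq_insert hS σ
  have h' := congrArg (Nat.cast : ℕ → ℚ) h
  push_cast [Nat.cast_sub hn] at h'
  linarith

/-! ### Closed forms by induction -/

theorem pinnacleSet_one (σ : Equiv.Perm (Fin 1)) : pinnacleSet σ = ∅ := by
  rw [pinnacleSet_eq_image, image_eq_empty, eq_empty_iff_forall_notMem]
  intro i hi
  have := mem_peaks.1 hi
  omega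

theorem pinnacleCount_one (S : Finset ℕ) : pinnacleCount S 1 = if S = ∅ then 1 else 0 := by
  rw [pinnacleCount_eq_sum]
  simp [pinnacleSet_one, eq_comm]

theorem pinnacleCount_empty (n : ℕ) : pinnacleCount ∅ (n + 1) = 2 ^ n := by
  induction n with
  | zero => simp [pinnacleCount_one]
  | succ n ih => rw [pinnacleCount_succ_of_notMem (by omega) (by simp), ih, pow_succ']

theorem sum_range_two_pow_sub (n : ℕ) :
    ∑ x ∈ range (n + 2), ((2 : ℚ) ^ (x - 2) - 1) = 2 ^ n - (n + 1) := by
  induction n with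
  | zero => norm_num [sum_range_succ]
  | succ n ih =>
    rw [sum_range_succ, ih, show n + 2 - 2 = n by omega]
    push_cast
    ring

/-- Allowing `l < 3`, where truncation makes both sides `0`, lets the recurrence sum over all `x`.
-/
theorem pinnacleCount_singleton (n : ℕ) : ∀ l ≤ n + 1,
    (pinnacleCount {l} (n + 1) : ℚ) = 2 ^ n / 2 * (2 ^ (l - 2) - 1) := by
  induction n with
  | zero =>
    intro l hl
    rw [show l - 2 = 0 by omega]
    simp [pinnacleCount_one]
  | succ n ih =>
    intro l hl
    rcases Nat.eq_or_lt_of_le hl with rfl | hl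
    · have h := pinnacleCount_insert_succ (n := n + 1) (by omega) (notMem_empty _)
      rw [insert_empty_eq] at h
      rw [h, pinnacleCount_empty, sdiff_empty]
      simp only [insert_empty_eq]
      rw [sum_congr rfl fun x hx => ih x (by have := mem_range.1 hx; omega), ← mul_sum,
        sum_range_two_pow_sub, show n + 1 + 1 - 2 = n by omega]
      push_cast
      simp only [card_empty]
      push_cast
      ring
    · rw [pinnacleCount_succ_of_notMem (by omega) (by simp; omega)]
      push_cast
      rw [ih l (by omega)]
      ring

/-- The coefficient `3 ^ (l - 1) - 2 ^ l + 1` divided by `2 ^ l`, and `0` for `l = 0`. -/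
def pairCoeff (l : ℕ) : ℚ := if l = 0 then 0 else (3 ^ (l - 1) - 2 ^ l + 1) / 2 ^ l

theorem sum_range_pairCoeff (l : ℕ) :
    ∑ x ∈ range (l + 1), pairCoeff x = (3 ^ l - l * 2 ^ l - 1) / 2 ^ l := by
  induction l with
  | zero => simp [pairCoeff]
  | succ l ih =>
    rw [sum_range_succ, ih, pairCoeff, if_neg (by omega), Nat.add_sub_cancel]
    push_cast
    field_simp
    ring

theorem sum_two_pow_Ioc {l : ℕ} (k : ℕ) :
    ∑ x ∈ Ioc l (l + k), (2 : ℚ) ^ x = 2 * 2 ^ (l + k) - 2 * 2 ^ l := by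
  induction k with
  | zero => simp
  | succ k ih =>
    rw [← add_assoc, ← insert_Ioc_right_eq_Ioc_add_one (by omega), sum_insert (by simp), ih]
    ring

theorem pinnacleCount_pair (n : ℕ) : ∀ l m, l < m → m ≤ n + 1 →
    (pinnacleCount {l, m} (n + 1) : ℚ) =
      2 ^ n * 2 ^ m / 16 * pairCoeff l - 2 ^ n / 4 * (2 ^ (l - 2) - 1) := by
  induction n with
  | zero =>
    intro l m hlm hm
    obtain rfl : l = 0 := by omega
    simp [pinnacleCount_one, pairCoeff]
  | succ n ih =>
    intro l m hlm hm
    rcases Nat.eq_or_lt_of_le hm with rfl | hm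
    · have h := pinnacleCount_insert_succ (n := n + 1) (S := {l}) (by omega) (by simp; omega)
      rw [pair_comm, h, pinnacleCount_singleton n l (by omega)]
      -- The destroyed pinnacle `x` is the smaller or the larger member of the pair `{x, l}`.
      have hsplit : range (n + 1 + 1) \ {l} = range l ∪ Ioc l (n + 1) := by
        ext x
        simp only [mem_sdiff, mem_range, mem_singleton, mem_union, mem_Ioc]
        omega
      have hdisj : Disjoint (range l) (Ioc l (n + 1)) := by
        rw [disjoint_left]
        intro x h1 h2
        rw [mem_range] at h1
        rw [mem_Ioc] at h2
        omega
      have h1 : ∑ x ∈ range l, (pinnacleCount (insert x {l}) (n + 1) : ℚ) =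
          2 ^ n * 2 ^ l / 16 * ∑ x ∈ range l, pairCoeff x -
            2 ^ n / 4 * ∑ x ∈ range l, ((2 : ℚ) ^ (x - 2) - 1) := by
        rw [mul_sum, mul_sum, ← sum_sub_distrib]
        exact sum_congr rfl fun x hx => ih x l (mem_range.1 hx) (by omega)
      have h2 : ∑ x ∈ Ioc l (n + 1), (pinnacleCount (insert x {l}) (n + 1) : ℚ) =
          2 ^ n / 16 * pairCoeff l * ∑ x ∈ Ioc l (n + 1), (2 : ℚ) ^ x -
            (n + 1 - l) * (2 ^ n / 4 * (2 ^ (l - 2) - 1)) := by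
        have hc : (n + 1 - l : ℚ) = ((Ioc l (n + 1)).card : ℚ) := by
          rw [Nat.card_Ioc, Nat.cast_sub (by omega)]
          push_cast
          ring
        rw [hc, ← nsmul_eq_mul, ← sum_const, mul_sum, ← sum_sub_distrib]
        refine sum_congr rfl fun x hx => ?_
        rw [mem_Ioc] at hx
        rw [pair_comm, ih l x hx.1 hx.2]
        ring
      rw [hsplit, sum_union hdisj, h1, h2]
      obtain ⟨k, hk⟩ : ∃ k, n + 1 = l + k := ⟨n + 1 - l, by omega⟩
      have h3 : ∑ x ∈ Ioc l (n + 1), (2 : ℚ) ^ x = 2 * 2 ^ (n + 1) - 2 * 2 ^ l := by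
        rw [hk, sum_two_pow_Ioc]
      rw [h3]
      -- For `l < 2` the exponent `l - 2` truncates, and `sum_range_two_pow_sub` does not apply.
      rcases l with _ | _ | l
      · simp [pairCoeff]
      · simp [pairCoeff]
        norm_num
      · rw [sum_range_two_pow_sub, sum_range_pairCoeff, pairCoeff, if_neg (by omega),
          show l + 1 + 1 - 2 = l by omega, show l + 1 + 1 - 1 = l + 1 by omega]
        push_cast
        simp only [card_singleton]
        push_cast
        field_simp
        ring
    · rw [pinnacleCount_succ_of_notMem (by omega) (by simp; omega)]
      push_cast
      rw [ih l m hlm (by omega)]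
      ring

end PinnacleSets

theorem mainTheorem8 (n : ℕ) (hn : 1 ≤ n) :
    ((PinnacleSets.pinnacleCount ∅ n : ℕ) : ℤ) = 2 ^ (n - 1) ∧
    (∀ l : ℕ, 3 ≤ l → l ≤ n →
      ((PinnacleSets.pinnacleCount {l} n : ℕ) : ℤ) = 2 ^ (n - 2) * (2 ^ (l - 2) - 1)) ∧
    (∀ l m : ℕ, 3 ≤ l → 5 ≤ m → l < m → m ≤ n →
      ((PinnacleSets.pinnacleCount {l, m} n : ℕ) : ℤ) =
        2 ^ (n + m - l - 5) * (3 ^ (l - 1) - 2 ^ l + 1) - 2 ^ (n - 3) * (2 ^ (l - 2) - 1)) := by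
  obtain ⟨n, rfl⟩ : ∃ k, n = k + 1 := ⟨n - 1, by omega⟩
  refine ⟨?_, ?_, ?_⟩
  · rw [PinnacleSets.pinnacleCount_empty]
    simp
  · intro l hl hln
    have h := PinnacleSets.pinnacleCount_singleton n l hln
    obtain ⟨k, rfl⟩ : ∃ k, n = k + 1 := ⟨n - 1, by omega⟩
    rw [← Int.cast_inj (α := ℚ)]
    push_cast
    rw [h]
    ring
  · intro l m hl hm hlm hmn
    have h := PinnacleSets.pinnacleCount_pair n l m hlm hmn
    -- From `5 ≤ m ≤ n + 1`; this makes the exponents in the statement untruncated.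
    obtain ⟨k, rfl⟩ : ∃ k, n = k + 4 := ⟨n - 4, by omega⟩
    obtain ⟨d, rfl⟩ : ∃ d, m = l + d := ⟨m - l, by omega⟩
    rw [← Int.cast_inj (α := ℚ)]
    push_cast
    rw [h, PinnacleSets.pairCoeff, if_neg (by omega),
      show k + 4 + 1 + (l + d) - l - 5 = k + d by omega]
    field_simp
    ring
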